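/- **Setting.** Let $X$, $V$ be finite-dimensional real inner product spaces, $Z$ a real inner product space, $\Omega$ a finite set of pixels (for gray images $V=\mathbb R$), $A:X\to Z$ a bounded linear operator, $u_0\in Z$, $\nabla=(\nabla_1,\nabla_2)$ a pair of linear maps $\nabla_l: X\to V^{\Omega}$ (a discrete gradient), and $\lambda,\mu>0$. Write $|\nabla u|^2(p)=\sum_{l=1}^2\|\nabla_l u(p)\|^2$, $f(u)=\tfrac12\|Au-u_0\|^2$ and $F=f+P$, where $P$ is one of $$P^I(u)=\sum_{p\in\Omega}\tfrac{\mu}{2}\min\big(|\nabla u|^2(p),\tfrac{\lambda}{\mu}\big)\ \text{(ITQ)},\qquad P^A(u)=\sum_{p\in\Omega}\tfrac{\mu}{2}\sum_{l=1}^{2}\min\big(\|\nabla_l u(p)\|^2,\tfrac{\lambda}{\mu}\big)\ \text{(ATQ)}.$$ Write $P=P_1-P_2$ with the convex functions $$P_1^I(u)=\sum_p\tfrac{\mu}{2}\big(|\nabla u|^2(p)+\tfrac{\lambda}{\mu}\big),\quad P_2^I(u)=\sum_p\tfrac{\mu}{2}\max\big(|\nabla u|^2(p),\tfrac{\lambda}{\mu}\big)$$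 for ITQ, and $$P_1^A(u)=\sum_p\tfrac{\mu}{2}\sum_{l}\big(\|\nabla_l u(p)\|^2+\tfrac{\lambda}{\mu}\big),\quad P_2^A(u)=\sum_p\tfrac{\mu}{2}\sum_{l}\max\big(\|\nabla_l u(p)\|^2,\tfrac{\lambda}{\mu}\big)$$ for ATQ. Assume that $F$ is level-bounded (every set $\{F\le\alpha\}$, $\alpha\in\mathbb R$, is bounded). Let $L\ge 0$ be a Lipschitz constant of $\nabla f$ and $M$ a self-adjoint positive definite operator on $X$ with $M\ge L I$; put $\|v\|_M^2=\langle v,Mv\rangle$. **Algorithm (preDCA$_e$).** Let $x^{-1}=x^0\in X$, $\beta_t\in[0,1)$ with $\sup_t\beta_t<1$, and for $t=0,1,2,\dots$ $$\xi^t\in\partial P_2(x^t),\qquad y^t=x^t+\beta_t(x^t-x^{t-1}),\qquad x^{t+1}=\operatorname*{arg\,min}_{z\in X}\Big\{\langle\nabla f(y^t)-\xi^t,z\rangle+\tfrac12\|z-y^t\|_M^2+P_1(z)\Big\},$$ where $\partial P_2$ is the convex subdifferential. The *standard choice* of $\xi^t$ is $\xi^t=\mu\sum_{l}\nabla_l^*\chi_l\nabla_l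 x^t$, where $\chi_l(p)=1$ if $|\nabla x^t|^2(p)\ge\lambda/\mu$ (ITQ), respectively if $\|\nabla_l x^t(p)\|^2\ge\lambda/\mu$ (ATQ), and $\chi_l(p)=0$ otherwise. A point $\bar x$ is a *stationary point* of $F$ if $0\in\partial F(\bar x)$, where $\partial F$ is the limiting subdifferential: $\xi\in\partial F(\bar x)$ iff there are $x_n\to\bar x$ with $F(x_n)\to F(\bar x)$ and $\xi_n\to\xi$ such that $\liminf_{y\to x_n,\,y\ne x_n}\frac{F(y)-F(x_n)-\langle\xi_n,y-x_n\rangle}{\|y-x_n\|}\ge0$ for every $n$. **Theorem.** Let $(x^t)$ be generated by preDCA$_e$ for ITQ or ATQ. 1. For every choice of the subgradients $\xi^t\in\partial P_2(x^t)$, every accumulation point $\bar x$ of $(x^t)$ satisfies $0\in\nabla f(\bar x)+\nabla P_1(\bar x)-\partial P_2(\bar x)$. 2. For the standard choice of $\xi^t$, every accumulation point of $(x^t)$ is a stationary point of $F$, one has $\sum_{t=1}^\infty\|x^t-x^{t-1}\|<\infty$, and the whole sequence $(x^t)$ converges to a stationary point of $F$. -/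

import Mathlib

open Filter Topology
open scoped NNReal RealInnerProductSpace

noncomputable section

/-- The two truncated quadratic models: isotropic (ITQ) and anisotropic (ATQ). -/
inductive TQKind where
  | iso
  | ani

/-- The data of a truncated quadratic problem on the finite dimensional image space `X`:
the operator `A`, the datum `u0`, the two components `grad 0`, `grad 1` of the discrete gradient
(arbitrary linear maps with values in the `V`-valued fields on the finite pixel set `Ω`; gray images
have `V = ℝ`), and the positive parameters `mu`, `lam`. -/
structure TQProblem (X Z V Ω : Type*)
    [NormedAddCommGroup X] [InnerProductSpace ℝ X]
    [NormedAddCommGroup Z] [InnerProductSpace ℝ Z]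
    [NormedAddCommGroup V] [InnerProductSpace ℝ V] where
  kind : TQKind
  A : X →L[ℝ] Z
  u0 : Z
  grad : Fin 2 → X →ₗ[ℝ] (Ω → V)
  mu : ℝ
  lam : ℝ
  mu_pos : 0 < mu
  lam_pos : 0 < lam

/-- The convex subdifferential of a real-valued function. -/
def convexSubdiff {X : Type*} [NormedAddCommGroup X] [InnerProductSpace ℝ X]
    (h : X → ℝ) (x : X) : Set X :=
  {ξ | ∀ y, h x + ⟪ξ, y - x⟫ ≤ h y}

/-- The regular (Fréchet) subdifferential of a real-valued function:
`liminf_{y → x, y ≠ x} (h y - h x - ⟨ξ, y - x⟩) / ‖y - x‖ ≥ 0`. -/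
def regularSubdiff {X : Type*} [NormedAddCommGroup X] [InnerProductSpace ℝ X]
    (h : X → ℝ) (x : X) : Set X :=
  {ξ | (0 : EReal) ≤
    liminf (fun y => (((h y - h x - ⟪ξ, y - x⟫) / ‖y - x‖ : ℝ) : EReal)) (𝓝[≠] x)}

/-- The limiting subdifferential of a real-valued function. -/
def limitingSubdiff {X : Type*} [NormedAddCommGroup X] [InnerProductSpace ℝ X]
    (h : X → ℝ) (x : X) : Set X :=
  {ξ | ∃ (xs ξs : ℕ → X), Tendsto xs atTop (𝓝 x) ∧ Tendsto (fun n => h (xs n)) atTop (𝓝 (h x)) ∧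
    Tendsto ξs atTop (𝓝 ξ) ∧ ∀ n, ξs n ∈ regularSubdiff h (xs n)}

/-- `x` is a stationary point of `h` if `0` is a limiting subgradient of `h` at `x`. -/
def IsLimitingStationary {X : Type*} [NormedAddCommGroup X] [InnerProductSpace ℝ X]
    (h : X → ℝ) (x : X) : Prop :=
  (0 : X) ∈ limitingSubdiff h x

/-- `h` is level-bounded: all its sublevel sets are bounded (possibly empty). -/
def LevelBounded {X : Type*} [NormedAddCommGroup X] (h : X → ℝ) : Prop :=
  ∀ α : ℝ, Bornology.IsBounded {u | h u ≤ α}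

namespace TQProblem

variable {X Z V Ω : Type*}
  [NormedAddCommGroup X] [InnerProductSpace ℝ X]
  [NormedAddCommGroup Z] [InnerProductSpace ℝ Z]
  [NormedAddCommGroup V] [InnerProductSpace ℝ V]

/-- The data term `f u = ‖A u - u0‖² / 2`. -/
def f (Q : TQProblem X Z V Ω) (u : X) : ℝ := ‖Q.A u - Q.u0‖ ^ 2 / 2

/-- `|∇_l u|²` at the pixel `p`. -/
def compSq (Q : TQProblem X Z V Ω) (l : Fin 2) (u : X) (p : Ω) : ℝ := ‖Q.grad l u p‖ ^ 2

/-- `|∇ u|² = |∇_1 u|² + |∇_2 u|²` at the pixel `p`. -/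
def gradSq (Q : TQProblem X Z V Ω) (u : X) (p : Ω) : ℝ := ∑ l, Q.compSq l u p

/-- The truncated quadratic regularizer `P^I` or `P^A`, summed over the pixels. -/
def P [Fintype Ω] (Q : TQProblem X Z V Ω) (u : X) : ℝ :=
  match Q.kind with
  | .iso => ∑ p, Q.mu / 2 * min (Q.gradSq u p) (Q.lam / Q.mu)
  | .ani => ∑ p, Q.mu / 2 * ∑ l, min (Q.compSq l u p) (Q.lam / Q.mu)

/-- The convex part `P_1^I` or `P_1^A`. -/
def P1 [Fintype Ω] (Q : TQProblem X Z V Ω) (u : X) : ℝ :=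
  match Q.kind with
  | .iso => ∑ p, Q.mu / 2 * (Q.gradSq u p + Q.lam / Q.mu)
  | .ani => ∑ p, Q.mu / 2 * ∑ l, (Q.compSq l u p + Q.lam / Q.mu)

/-- The convex part `P_2^I` or `P_2^A`; one has `P = P1 - P2`. -/
def P2 [Fintype Ω] (Q : TQProblem X Z V Ω) (u : X) : ℝ :=
  match Q.kind with
  | .iso => ∑ p, Q.mu / 2 * max (Q.gradSq u p) (Q.lam / Q.mu)
  | .ani => ∑ p, Q.mu / 2 * ∑ l, max (Q.compSq l u p) (Q.lam / Q.mu)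

/-- The objective `F = f + P`. -/
def F [Fintype Ω] (Q : TQProblem X Z V Ω) (u : X) : ℝ := Q.f u + Q.P u

open Classical in
/-- The indicator `χ` of the pixels (and, in the anisotropic case, of the directions `l`) where the
quadratic is truncated, with the value `1` at the threshold. -/
def chi (Q : TQProblem X Z V Ω) (u : X) (l : Fin 2) (p : Ω) : ℝ :=
  match Q.kind with
  | .iso => if Q.lam / Q.mu ≤ Q.gradSq u p then 1 else 0
  | .ani => if Q.lam / Q.mu ≤ Q.compSq l u p then 1 else 0

/-- The selection `μ ∇^* χ ∇ u` (isotropic) or `μ ∑ l, ∇_l^* χ_l ∇_l u` (anisotropic) of the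
subdifferential of `P2` at `u`. -/
def subgradSel [Fintype Ω] [FiniteDimensional ℝ X] [FiniteDimensional ℝ V]
    (Q : TQProblem X Z V Ω) (u : X) : X :=
  Q.mu • ∑ l, ∑ p,
    LinearMap.adjoint ((LinearMap.proj p : (Ω → V) →ₗ[ℝ] V) ∘ₗ Q.grad l)
      (Q.chi u l p • Q.grad l u p)

/-- The sequences `x`, `y`, `ξ` are generated by the preconditioned DCA with extrapolation, with
preconditioning metric `M` and extrapolation parameters `β`. The convention `x^{-1} = x^0` is
`x (0 - 1) = x 0`. -/
structure IsPreDCAe [Fintype Ω] [CompleteSpace X] (Q : TQProblem X Z V Ω) (M : X →ₗ[ℝ] X)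
    (β : ℕ → ℝ) (x y ξ : ℕ → X) : Prop where
  beta_mem : ∀ t, β t ∈ Set.Ico (0 : ℝ) 1
  beta_sup : ⨆ t, β t < 1
  subgrad : ∀ t, ξ t ∈ convexSubdiff Q.P2 (x t)
  extrapolate : ∀ t, y t = x t + β t • (x t - x (t - 1))
  argmin : ∀ t, IsMinOn
    (fun z => ⟪gradient Q.f (y t) - ξ t, z⟫ + 1 / 2 * ⟪z - y t, M (z - y t)⟫ + Q.P1 z)
    Set.univ (x (t + 1))

end TQProblem

end

/-!
Since `f` and `P1` are quadratic, the three-point inequality of one step reads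
`F (x (t + 1)) + n (t + 1) ≤ F (x t) + β t ^ 2 * n t`, where `n t` is half the squared `M`-length of
`x t - x (t - 1)`. As `sup β < 1`, a combination of `F (x t)` and `n t` decreases by a multiple of
`n t + n (t + 1)`; hence the steps tend to `0`, and accumulation points inherit the optimality
condition of the subproblem.

On each of the finitely many sets where `chi` is constant, `F` coincides with a quadratic function.
For the standard choice of subgradients, the gradient at `x t` of that branch is of the order of the
two steps at `x t`. A quadratic satisfies the Łojasiewicz inequality with exponent `1 / 2` globally,
so the energy gap is bounded by its own decrease, hence decays geometrically, and the steps are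
summable.
The gradient of the branch at `u` is a limit of gradients of `F` at `(1 + ε) • u`, where `F` is
differentiable even if `u` lies on the threshold, which gives limiting stationarity.
-/

open Asymptotics

section Subdifferentials

variable {X : Type*} [NormedAddCommGroup X] [InnerProductSpace ℝ X] {h : X → ℝ} {a ξ : X}

theorem mem_convexSubdiff_of_tendsto {ι : Type*} {l : Filter ι} [l.NeBot] {x ζ : ι → X}
    (hh : ContinuousAt h a) (hx : Tendsto x l (𝓝 a)) (hζ : Tendsto ζ l (𝓝 ξ))
    (hmem : ∀ i, ζ i ∈ convexSubdiff h (x i)) : ξ ∈ convexSubdiff h a := fun v =>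
  le_of_tendsto' ((hh.tendsto.comp hx).add (hζ.inner (hx.const_sub v))) fun i => hmem i v

theorem mem_regularSubdiff_of_hasGradientAt [CompleteSpace X] (hg : HasGradientAt h ξ a) :
    ξ ∈ regularSubdiff h a := by
  have hquot : Tendsto (fun y => (h y - h a - ⟪ξ, y - a⟫) / ‖y - a‖) (𝓝[≠] a) (𝓝 0) := by
    refine tendsto_zero_iff_norm_tendsto_zero.2 ?_
    refine ((hasGradientAt_iff_tendsto.1 hg).mono_left nhdsWithin_le_nhds).congr fun y => ?_
    rw [norm_div, norm_norm, div_eq_inv_mul]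
  rcases eq_or_neBot (𝓝[≠] a) with hbot | _
  · simp [regularSubdiff, hbot]
  · exact ((continuous_coe_real_ereal.tendsto 0).comp hquot).liminf_eq.ge

theorem mem_limitingSubdiff_of_mem_closure (hh : ContinuousAt h a)
    (hmem : (a, ξ) ∈ closure {z : X × X | z.2 ∈ regularSubdiff h z.1}) :
    ξ ∈ limitingSubdiff h a := by
  obtain ⟨z, hz, hlim⟩ := mem_closure_iff_seq_limit.1 hmem
  exact ⟨fun n => (z n).1, fun n => (z n).2, hlim.fst_nhds, hh.tendsto.comp hlim.fst_nhds,
    hlim.snd_nhds, hz⟩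

end Subdifferentials

section LinearMaps

variable {X Y : Type*} [NormedAddCommGroup X] [InnerProductSpace ℝ X] [FiniteDimensional ℝ X]
  [NormedAddCommGroup Y] [InnerProductSpace ℝ Y]

theorem isBigO_linearMap_comp {ι : Type*} (K : X →ₗ[ℝ] Y) (v : ι → X) (l : Filter ι) :
    (fun i => K (v i)) =O[l] v :=
  K.toContinuousLinearMap.isBigO_comp v l

theorem exists_pos_mul_norm_sq_le_inner {M : X →ₗ[ℝ] X} (hM : ∀ v, v ≠ 0 → 0 < ⟪v, M v⟫) :
    ∃ m, 0 < m ∧ ∀ v, m * ‖v‖ ^ 2 ≤ ⟪v, M v⟫ := by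
  have hcont : Continuous fun v => ⟪v, M v⟫ :=
    continuous_id.inner M.continuous_of_finiteDimensional
  obtain ⟨m, hm, hsphere⟩ := (isCompact_sphere (0 : X) 1).exists_forall_le' hcont.continuousOn
    fun v hv => hM v (ne_zero_of_mem_unit_sphere ⟨v, hv⟩)
  refine ⟨m, hm, fun v => ?_⟩
  rcases eq_or_ne v 0 with rfl | hv
  · simp
  have hv' : ‖v‖ ≠ 0 := norm_ne_zero_iff.2 hv
  have hunit := hsphere (‖v‖⁻¹ • v) (by simp [norm_smul, hv'])
  rw [map_smul, real_inner_smul_left, real_inner_smul_right] at hunit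
  calc m * ‖v‖ ^ 2 ≤ ‖v‖⁻¹ * (‖v‖⁻¹ * ⟪v, M v⟫) * ‖v‖ ^ 2 := by gcongr
    _ = ⟪v, M v⟫ := by field_simp

theorem exists_abs_inner_le_mul_norm_sq {K : X →ₗ[ℝ] X} (hK : K.IsSymmetric) :
    ∃ C, ∀ v, |⟪K v, v⟫| ≤ C * ‖K v‖ ^ 2 := by
  obtain ⟨C, -, hC⟩ := K.rangeRestrict.toContinuousLinearMap.exists_preimage_norm_le
    K.surjective_rangeRestrict
  refine ⟨C, fun v => ?_⟩
  obtain ⟨w, hw, hwC⟩ := hC (K.rangeRestrict v)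
  have hKw : K w = K v := congrArg Subtype.val hw
  calc |⟪K v, v⟫| = |⟪w, K v⟫| := by rw [← hKw, hK w v, hKw]
    _ ≤ ‖w‖ * ‖K v‖ := abs_real_inner_le_norm _ _
    _ ≤ C * ‖K v‖ * ‖K v‖ := by gcongr; exact hwC
    _ = C * ‖K v‖ ^ 2 := by ring

/-- The operator `A^* A`, for `A` defined on a finite dimensional space. The codomain need not be
complete, so the adjoint is that of `A` with values in its range. -/
noncomputable def gram (A : X →ₗ[ℝ] Y) : X →ₗ[ℝ] X :=
  LinearMap.adjoint A.rangeRestrict ∘ₗ A.rangeRestrict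

theorem inner_gram (A : X →ₗ[ℝ] Y) (u v : X) : ⟪gram A u, v⟫ = ⟪A u, A v⟫ :=
  LinearMap.adjoint_inner_left A.rangeRestrict v (A.rangeRestrict u)

theorem inner_gram_self (A : X →ₗ[ℝ] Y) (u : X) : ⟪gram A u, u⟫ = ‖A u‖ ^ 2 := by
  rw [inner_gram, real_inner_self_eq_norm_sq]

theorem isSymmetric_gram (A : X →ₗ[ℝ] Y) : (gram A).IsSymmetric := fun u v => by
  rw [inner_gram, real_inner_comm, ← inner_gram, real_inner_comm]

theorem gram_apply [FiniteDimensional ℝ Y] (A : X →ₗ[ℝ] Y) (u : X) :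
    gram A u = LinearMap.adjoint A (A u) :=
  ext_inner_right ℝ fun v => by rw [inner_gram, LinearMap.adjoint_inner_left]

end LinearMaps

/-- `q` is a quadratic polynomial on `X` with gradient map `q'` and (constant) Hessian `K`, encoded
by its exact second order Taylor expansion at every point. -/
structure IsQuadratic {X : Type*} [NormedAddCommGroup X] [InnerProductSpace ℝ X]
    (q : X → ℝ) (q' : X → X) (K : X →ₗ[ℝ] X) : Prop where
  symm : K.IsSymmetric
  expansion : ∀ u v, q v = q u + ⟪q' u, v - u⟫ + 1 / 2 * ⟪K (v - u), v - u⟫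

section HalfInner

variable {X : Type*} [NormedAddCommGroup X] [InnerProductSpace ℝ X] {K M : X →ₗ[ℝ] X}

theorem isQuadratic_half_inner (hK : K.IsSymmetric) (k : ℝ) :
    IsQuadratic (fun u => 1 / 2 * ⟪K u, u⟫ + k) K K where
  symm := hK
  expansion u v := by
    have hcomm : ⟪K v, u⟫ = ⟪K u, v⟫ := by rw [hK v u, real_inner_comm]
    simp only [map_sub, inner_sub_left, inner_sub_right, hcomm]
    ring

theorem isQuadratic_inner_add_half_inner_sub (hM : M.IsSymmetric) (ζ w : X) :
    IsQuadratic (fun z => ⟪ζ, z⟫ + 1 / 2 * ⟪z - w, M (z - w)⟫) (fun z => ζ + M (z - w)) M where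
  symm := hM
  expansion u v := by
    have hquad := (isQuadratic_half_inner hM 0).expansion (u - w) (v - w)
    rw [sub_sub_sub_cancel_right, hM (v - w) (v - w), hM (u - w) (u - w)] at hquad
    rw [inner_add_left, inner_sub_right ζ]
    linarith

end HalfInner

namespace IsQuadratic

variable {X : Type*} [NormedAddCommGroup X] [InnerProductSpace ℝ X] {q p : X → ℝ} {q' p' : X → X}
  {K H : X →ₗ[ℝ] X}

theorem add (hq : IsQuadratic q q' K) (hp : IsQuadratic p p' H) :
    IsQuadratic (fun u => q u + p u) (fun u => q' u + p' u) (K + H) where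
  symm := hq.symm.add hp.symm
  expansion u v := by
    rw [hq.expansion u v, hp.expansion u v, LinearMap.add_apply, inner_add_left, inner_add_left]
    ring

theorem gradient_sub (hq : IsQuadratic q q' K) (u v : X) : q' v - q' u = K (v - u) := by
  refine ext_inner_right ℝ fun e => ?_
  have huw := hq.expansion u (v + e)
  have hvw := hq.expansion v (v + e)
  have huv := hq.expansion u v
  have hcomm : ⟪K e, v - u⟫ = ⟪K (v - u), e⟫ := by rw [hq.symm, real_inner_comm]
  rw [add_sub_right_comm] at huw
  rw [add_sub_cancel_left] at hvw
  simp only [map_add, inner_add_left, inner_add_right, hcomm] at huw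
  rw [inner_sub_left]
  linarith

section FiniteDimensional

variable [FiniteDimensional ℝ X]

theorem continuous_gradient (hq : IsQuadratic q q' K) : Continuous q' := by
  have haffine (u : X) : q' u = K u + q' 0 := by
    rw [← sub_eq_iff_eq_add, hq.gradient_sub, sub_zero]
  exact funext haffine ▸ K.continuous_of_finiteDimensional.add_const (q' 0)

/-- Since the range of `K` is closed, the values `K u = q' u - q' 0` attain their limit `-q' 0`. -/
theorem exists_gradient_eq_zero_of_tendsto {ι : Type*} {l : Filter ι} [l.NeBot] {x : ι → X}
    (hq : IsQuadratic q q' K) (hx : Tendsto (fun i => q' (x i)) l (𝓝 0)) : ∃ a, q' a = 0 := by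
  have hK : Tendsto (fun i => K (x i)) l (𝓝 (0 - q' 0)) :=
    (hx.sub_const (q' 0)).congr fun i => by rw [hq.gradient_sub, sub_zero]
  obtain ⟨a, ha⟩ := (Submodule.closed_of_finiteDimensional K.range).mem_of_tendsto hK
    (Eventually.of_forall fun i => K.mem_range_self (x i))
  refine ⟨a, ?_⟩
  have hsub := hq.gradient_sub 0 a
  rw [sub_zero, ha] at hsub
  exact sub_left_injective hsub

theorem exists_abs_sub_le_mul_norm_gradient_sq (hq : IsQuadratic q q' K) :
    ∃ C, ∀ a u, q' a = 0 → |q u - q a| ≤ C * ‖q' u‖ ^ 2 := by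
  obtain ⟨C, hC⟩ := exists_abs_inner_le_mul_norm_sq hq.symm
  refine ⟨1 / 2 * C, fun a u ha => ?_⟩
  have hgrad : q' u = K (u - a) := by rw [← hq.gradient_sub, ha, sub_zero]
  have hval : q u - q a = 1 / 2 * ⟪K (u - a), u - a⟫ := by
    rw [hq.expansion a u, ha, inner_zero_left]
    ring
  rw [hval, hgrad, abs_mul, abs_of_pos one_half_pos, mul_assoc]
  exact mul_le_mul_of_nonneg_left (hC (u - a)) one_half_pos.le

/-- The Łojasiewicz inequality with exponent `1 / 2`: no boundedness is required, because all
critical values of `q` agree and `q (x i)` can only converge to that value. -/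
theorem isBigO_sub_gradient_sq {ι : Type*} {l : Filter ι} {x : ι → X} {E : ℝ}
    (hq : IsQuadratic q q' K) (hE : Tendsto (fun i => q (x i)) l (𝓝 E))
    (hx : Tendsto (fun i => q' (x i)) l (𝓝 0)) :
    (fun i => q (x i) - E) =O[l] fun i => ‖q' (x i)‖ ^ 2 := by
  rcases eq_or_neBot l with rfl | _
  · simp [isBigO_iff]
  obtain ⟨a, ha⟩ := hq.exists_gradient_eq_zero_of_tendsto hx
  obtain ⟨C, hC⟩ := hq.exists_abs_sub_le_mul_norm_gradient_sq
  have hsub : (fun i => q (x i) - q a) =O[l] fun i => ‖q' (x i)‖ ^ 2 :=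
    IsBigO.of_bound C <| Eventually.of_forall fun i => by
      simpa only [Real.norm_eq_abs, abs_of_nonneg (sq_nonneg ‖q' (x i)‖)] using hC a (x i) ha
  have hsq : Tendsto (fun i => ‖q' (x i)‖ ^ 2) l (𝓝 0) := by simpa using hx.norm.pow 2
  have hEa : E = q a :=
    tendsto_nhds_unique hE (tendsto_sub_nhds_zero_iff.1 (hsub.trans_tendsto hsq))
  rwa [hEa]

variable [CompleteSpace X]

theorem hasGradientAt (hq : IsQuadratic q q' K) (u : X) : HasGradientAt q (q' u) u := by
  rw [hasGradientAt_iff_isLittleO]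
  have hK : (fun v => K (v - u)) =o[𝓝 u] fun _ => (1 : ℝ) := by
    rw [isLittleO_one_iff]
    have hcont : Continuous fun v => K (v - u) :=
      K.continuous_of_finiteDimensional.comp (continuous_sub_right u)
    simpa using hcont.tendsto u
  have hinner : (fun v => ⟪K (v - u), v - u⟫) =o[𝓝 u] fun v => v - u := by
    have hprod : (fun v => ‖K (v - u)‖ * ‖v - u‖) =o[𝓝 u] fun v => v - u := by
      simpa only [one_mul, isLittleO_norm_right] using
        hK.norm_left.mul_isBigO (isBigO_refl (fun v => ‖v - u‖) _)
    exact (IsBigO.of_norm_le fun v => norm_inner_le_norm (𝕜 := ℝ) _ _).trans_isLittleO hprod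
  refine (hinner.const_mul_left (1 / 2)).congr_left fun v => ?_
  rw [hq.expansion u v]
  ring

theorem gradient_eq (hq : IsQuadratic q q' K) : gradient q = q' :=
  _root_.gradient_eq hq.hasGradientAt

theorem continuous (hq : IsQuadratic q q' K) : Continuous q :=
  continuous_iff_continuousAt.2 fun u => (hq.hasGradientAt u).continuousAt

theorem gradient_eq_zero_of_isMinOn (hq : IsQuadratic q q' K) {u : X}
    (hu : IsMinOn q Set.univ u) : q' u = 0 :=
  (InnerProductSpace.toDual ℝ X).map_eq_zero_iff.1
    ((hu.isLocalMin univ_mem).hasFDerivAt_eq_zero (hq.hasGradientAt u).hasFDerivAt)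

end FiniteDimensional

end IsQuadratic

section ProximalStep

variable {X : Type*} [NormedAddCommGroup X] [InnerProductSpace ℝ X] [FiniteDimensional ℝ X]
  [CompleteSpace X]

theorem IsQuadratic.add_sub_le_of_isMinOn {f g h : X → ℝ} {f' g' : X → X} {T H M : X →ₗ[ℝ] X}
    {p u w ξ : X} (hf : IsQuadratic f f' T) (hg : IsQuadratic g g' H) (hM : M.IsSymmetric)
    (hT : ∀ v, 0 ≤ ⟪T v, v⟫) (hTM : ∀ v, ⟪T v, v⟫ ≤ ⟪v, M v⟫) (hH : ∀ v, 0 ≤ ⟪H v, v⟫)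
    (hξ : ξ ∈ convexSubdiff h u)
    (hp : IsMinOn (fun z => ⟪f' w - ξ, z⟫ + 1 / 2 * ⟪z - w, M (z - w)⟫ + g z) Set.univ p) :
    f p + g p - h p + 1 / 2 * ⟪p - u, M (p - u)⟫ ≤
      f u + g u - h u + 1 / 2 * ⟪u - w, M (u - w)⟫ := by
  have hmajorant : f p ≤ f w + ⟪f' w, p - w⟫ + 1 / 2 * ⟪p - w, M (p - w)⟫ := by
    linarith [hf.expansion w p, hTM (p - w)]
  have hminorant : f w + ⟪f' w, u - w⟫ ≤ f u := by
    linarith [hf.expansion w u, hT (u - w)]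
  have hsubgrad : h u + ⟪ξ, p - u⟫ ≤ h p := hξ p
  have hmodel := (isQuadratic_inner_add_half_inner_sub hM (f' w - ξ) w).add hg
  have hthreePoint : ⟪f' w - ξ, p⟫ + 1 / 2 * ⟪p - w, M (p - w)⟫ + g p +
      1 / 2 * ⟪p - u, M (p - u)⟫ ≤ ⟪f' w - ξ, u⟫ + 1 / 2 * ⟪u - w, M (u - w)⟫ + g u := by
    have hexp := hmodel.expansion p u
    rw [hmodel.gradient_eq_zero_of_isMinOn hp, inner_zero_left, LinearMap.add_apply,
      inner_add_left, ← neg_sub p u, map_neg, map_neg, inner_neg_neg, inner_neg_neg,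
      hM (p - u) (p - u)] at hexp
    linarith [hH (p - u)]
  rw [inner_sub_right] at hmajorant hminorant hsubgrad
  rw [inner_sub_left (f' w) ξ p, inner_sub_left (f' w) ξ u] at hthreePoint
  linarith

end ProximalStep

section Sequences

theorem isBigO_of_finite_range {ι γ : Type*} {l : Filter ι} {f g : ι → ℝ} {χ : ι → γ}
    (hχ : (Set.range χ).Finite) (h : ∀ c, f =O[l ⊓ 𝓟 (χ ⁻¹' {c})] g) : f =O[l] g := by
  have hsub : ∀ s : Set γ, s.Finite → f =O[l ⊓ 𝓟 (χ ⁻¹' s)] g := fun s hs => by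
    induction s, hs using Set.Finite.induction_on with
    | empty => simp [isBigO_iff]
    | @insert c s _ _ ih =>
      rw [Set.insert_eq, Set.preimage_union, ← sup_principal, inf_sup_left]
      exact (h c).sup ih
  simpa only [Set.preimage_range, principal_univ, inf_top_eq] using hsub _ hχ

theorem summable_sqrt_of_isBigO_sub_succ {r : ℕ → ℝ} (hr : ∀ t, 0 ≤ r t)
    (hO : r =O[atTop] fun t => r t - r (t + 1)) (hanti : Antitone r) :
    Summable fun t => √(r t) := by
  obtain ⟨C, hC, hbound⟩ := hO.exists_pos
  have hratio : √(1 - C⁻¹) < 1 := by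
    rw [Real.sqrt_lt' one_pos, one_pow]
    exact sub_lt_self 1 (inv_pos.2 hC)
  refine summable_of_ratio_norm_eventually_le hratio (hbound.bound.mono fun t ht => ?_)
  rw [Real.norm_of_nonneg (hr t), Real.norm_of_nonneg (sub_nonneg.2 (hanti t.le_succ))] at ht
  have hcontract : r (t + 1) ≤ (1 - C⁻¹) * r t := by
    have := (inv_mul_le_iff₀ hC).2 ht
    linarith
  rw [Real.norm_of_nonneg (Real.sqrt_nonneg _), Real.norm_of_nonneg (Real.sqrt_nonneg _),
    ← Real.sqrt_mul' _ (hr t)]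
  exact Real.sqrt_le_sqrt hcontract

section TwoSteps

variable {n : ℕ → ℝ} (hn : ∀ t, 0 ≤ n t)
include hn

theorem isBigO_add_succ_left : n =O[atTop] fun t => n t + n (t + 1) :=
  IsBigO.of_norm_le fun t => by
    rw [Real.norm_of_nonneg (hn t)]
    exact le_add_of_nonneg_right (hn (t + 1))

theorem isBigO_add_succ_right : (fun t => n (t + 1)) =O[atTop] fun t => n t + n (t + 1) :=
  IsBigO.of_norm_le fun t => by
    rw [Real.norm_of_nonneg (hn (t + 1))]
    exact le_add_of_nonneg_left (hn t)

end TwoSteps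

/-- The one-step inequality of a descent method with inertia: `φ t` is the objective and `n t` half
the squared length of the last step, and the extrapolation may increase `φ` by at most `b * n t`. -/
structure IsInertialDescent (φ n : ℕ → ℝ) (b : ℝ) : Prop where
  nonneg_b : 0 ≤ b
  b_lt_one : b < 1
  nonneg : ∀ t, 0 ≤ n t
  bddBelow : BddBelow (Set.range φ)
  step : ∀ t, φ (t + 1) + n (t + 1) ≤ φ t + b * n t

namespace IsInertialDescent

/-- The Lyapunov function of an inertial descent. The weight is the midpoint of `b` and `1`, so that
a fixed fraction of both `n t` and `n (t + 1)` is gained in each step. -/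
noncomputable def energy (φ n : ℕ → ℝ) (b : ℝ) (t : ℕ) : ℝ := φ t + (b + 1) / 2 * n t

variable {φ n : ℕ → ℝ} {b : ℝ}

theorem mul_add_le_energy_sub (h : IsInertialDescent φ n b) (t : ℕ) :
    (1 - b) / 2 * (n t + n (t + 1)) ≤ energy φ n b t - energy φ n b (t + 1) := by
  unfold energy
  linarith [h.step t]

theorem antitone_energy (h : IsInertialDescent φ n b) : Antitone (energy φ n b) :=
  antitone_nat_of_succ_le fun t => sub_nonneg.1 <|
    (mul_nonneg (half_pos (sub_pos.2 h.b_lt_one)).le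
      (add_nonneg (h.nonneg t) (h.nonneg (t + 1)))).trans (h.mul_add_le_energy_sub t)

theorem bddBelow_energy (h : IsInertialDescent φ n b) : BddBelow (Set.range (energy φ n b)) :=
  h.bddBelow.range_mono _ fun t => le_add_of_nonneg_right <|
    mul_nonneg (by linarith [h.nonneg_b]) (h.nonneg t)

theorem tendsto_energy (h : IsInertialDescent φ n b) :
    Tendsto (energy φ n b) atTop (𝓝 (⨅ t, energy φ n b t)) :=
  tendsto_atTop_ciInf h.antitone_energy h.bddBelow_energy

theorem add_isBigO_energy_sub (h : IsInertialDescent φ n b) :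
    (fun t => n t + n (t + 1)) =O[atTop] fun t => energy φ n b t - energy φ n b (t + 1) := by
  have hb : 0 < (1 - b) / 2 := half_pos (sub_pos.2 h.b_lt_one)
  refine IsBigO.of_bound ((1 - b) / 2)⁻¹ (Eventually.of_forall fun t => ?_)
  rw [Real.norm_of_nonneg (add_nonneg (h.nonneg t) (h.nonneg (t + 1))), le_inv_mul_iff₀ hb]
  exact (h.mul_add_le_energy_sub t).trans (le_abs_self _)

theorem tendsto_zero (h : IsInertialDescent φ n b) : Tendsto n atTop (𝓝 0) := by
  have hdecrease := h.tendsto_energy.sub (h.tendsto_energy.comp (tendsto_add_atTop_nat 1))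
  rw [sub_self] at hdecrease
  exact ((isBigO_add_succ_left h.nonneg).trans h.add_isBigO_energy_sub).trans_tendsto hdecrease

theorem tendsto_objective (h : IsInertialDescent φ n b) :
    Tendsto φ atTop (𝓝 (⨅ t, energy φ n b t)) := by
  simpa [energy] using h.tendsto_energy.sub (h.tendsto_zero.const_mul ((b + 1) / 2))

theorem summable_sqrt (h : IsInertialDescent φ n b)
    (hgap : (fun t => φ t - ⨅ t, energy φ n b t) =O[atTop] fun t => n t + n (t + 1)) :
    Summable fun t => √(n t) := by
  set e := energy φ n b with he
  set r : ℕ → ℝ := fun t => e t - ⨅ t, e t with hr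
  have hstep : (fun t => n t + n (t + 1)) =O[atTop] fun t => r t - r (t + 1) := by
    simpa only [hr, sub_sub_sub_cancel_right] using h.add_isBigO_energy_sub
  have hrO : r =O[atTop] fun t => r t - r (t + 1) := by
    have hnO := (isBigO_add_succ_left h.nonneg).const_mul_left ((b + 1) / 2)
    refine IsBigO.trans ((hgap.add hnO).congr_left fun t => ?_) hstep
    simp only [hr, he, energy]
    ring
  have hnonneg (t : ℕ) : 0 ≤ r t := sub_nonneg.2 (ciInf_le h.bddBelow_energy t)
  have hsummable : Summable fun t => √(r t) := summable_sqrt_of_isBigO_sub_succ hnonneg hrO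
    fun s t hst => sub_le_sub_right (h.antitone_energy hst) _
  have hnr : n =O[atTop] r := ((isBigO_add_succ_left h.nonneg).trans hstep).trans <|
    IsBigO.of_norm_le fun t => by
      have hdecrease : 0 ≤ r t - r (t + 1) := by
        simpa only [hr, sub_sub_sub_cancel_right, sub_nonneg] using h.antitone_energy t.le_succ
      rw [Real.norm_of_nonneg hdecrease]
      exact sub_le_self _ (hnonneg (t + 1))
  exact summable_of_isBigO_nat hsummable (hnr.sqrt (Eventually.of_forall hnonneg))

end IsInertialDescent

end Sequences

section Steps

variable {X : Type*} [NormedAddCommGroup X] [InnerProductSpace ℝ X]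

/-- Half of the squared `M`-length of the step that leads to `x t`. -/
noncomputable def stepEnergy (M : X →ₗ[ℝ] X) (x : ℕ → X) (t : ℕ) : ℝ :=
  1 / 2 * ⟪x t - x (t - 1), M (x t - x (t - 1))⟫

/-- The combined `M`-length of the steps into and out of `x t`, which bounds all residuals of the
algorithm at `x t`. -/
noncomputable def twoStepLength (M : X →ₗ[ℝ] X) (x : ℕ → X) (t : ℕ) : ℝ :=
  √(stepEnergy M x t + stepEnergy M x (t + 1))

variable [FiniteDimensional ℝ X] {M : X →ₗ[ℝ] X} (hMpos : ∀ v, v ≠ 0 → 0 < ⟪v, M v⟫) (x : ℕ → X)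
include hMpos

theorem stepEnergy_nonneg (t : ℕ) : 0 ≤ stepEnergy M x t := by
  obtain ⟨m, hm, hcoercive⟩ := exists_pos_mul_norm_sq_le_inner hMpos
  exact mul_nonneg one_half_pos.le ((mul_nonneg hm.le (sq_nonneg _)).trans (hcoercive _))

theorem sub_isBigO_sqrt_stepEnergy :
    (fun t => x t - x (t - 1)) =O[atTop] fun t => √(stepEnergy M x t) := by
  obtain ⟨m, hm, hcoercive⟩ := exists_pos_mul_norm_sq_le_inner hMpos
  refine IsBigO.of_bound √(2 / m) (Eventually.of_forall fun t => ?_)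
  rw [Real.norm_of_nonneg (Real.sqrt_nonneg _), ← Real.sqrt_mul (by positivity)]
  refine Real.le_sqrt_of_sq_le ?_
  calc ‖x t - x (t - 1)‖ ^ 2 = m⁻¹ * (m * ‖x t - x (t - 1)‖ ^ 2) := by field_simp
    _ ≤ m⁻¹ * ⟪x t - x (t - 1), M (x t - x (t - 1))⟫ := by gcongr; exact hcoercive _
    _ = 2 / m * stepEnergy M x t := by rw [stepEnergy]; ring

theorem sub_isBigO_twoStepLength :
    (fun t => x t - x (t - 1)) =O[atTop] twoStepLength M x :=
  (sub_isBigO_sqrt_stepEnergy hMpos x).trans <|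
    (isBigO_add_succ_left (stepEnergy_nonneg hMpos x)).sqrt <| Eventually.of_forall fun t =>
      add_nonneg (stepEnergy_nonneg hMpos x t) (stepEnergy_nonneg hMpos x (t + 1))

theorem succ_sub_isBigO_twoStepLength :
    (fun t => x (t + 1) - x t) =O[atTop] twoStepLength M x :=
  ((sub_isBigO_sqrt_stepEnergy hMpos x).comp_tendsto (tendsto_add_atTop_nat 1)).trans <|
    (isBigO_add_succ_right (stepEnergy_nonneg hMpos x)).sqrt <| Eventually.of_forall fun t =>
      add_nonneg (stepEnergy_nonneg hMpos x t) (stepEnergy_nonneg hMpos x (t + 1))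

theorem twoStepLength_sq (t : ℕ) :
    twoStepLength M x t ^ 2 = stepEnergy M x t + stepEnergy M x (t + 1) :=
  Real.sq_sqrt (add_nonneg (stepEnergy_nonneg hMpos x t) (stepEnergy_nonneg hMpos x (t + 1)))

end Steps

theorem tendsto_one_add_smul_nhds {E : Type*} [AddCommMonoid E] [Module ℝ E] [TopologicalSpace E]
    [ContinuousSMul ℝ E] (u : E) :
    Tendsto (fun ε : ℝ => (1 + ε) • u) (𝓝[>] 0) (𝓝 u) := by
  have hcont : Continuous fun ε : ℝ => (1 + ε) • u := by fun_prop
  simpa using (hcont.tendsto 0).mono_left nhdsWithin_le_nhds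

namespace TQProblem

variable {X Z V Ω : Type*} [NormedAddCommGroup X] [InnerProductSpace ℝ X]
  [NormedAddCommGroup Z] [InnerProductSpace ℝ Z] [NormedAddCommGroup V] [InnerProductSpace ℝ V]
  (Q : TQProblem X Z V Ω)

section Threshold

/-- The quantity compared with the threshold `λ / μ` at direction `l` and pixel `p`: `|∇ u|² (p)` in
the isotropic and `‖∇_l u (p)‖²` in the anisotropic model. -/
def truncArg (u : X) (l : Fin 2) (p : Ω) : ℝ :=
  match Q.kind with
  | .iso => Q.gradSq u p
  | .ani => Q.compSq l u p

open Classical in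
theorem chi_eq_ite (u : X) (l : Fin 2) (p : Ω) :
    Q.chi u l p = if Q.lam / Q.mu ≤ Q.truncArg u l p then 1 else 0 := by
  unfold chi truncArg
  cases Q.kind <;> rfl

theorem finite_range_chi [Finite Ω] : (Set.range Q.chi).Finite := by
  have hcube : (Set.univ.pi fun _ : Fin 2 =>
      Set.univ.pi fun _ : Ω => ({0, 1} : Set ℝ)).Finite :=
    Set.Finite.pi fun _ => Set.Finite.pi fun _ => Set.toFinite _
  refine hcube.subset ?_
  rintro _ ⟨u, rfl⟩ l _ p _
  rw [chi_eq_ite]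
  split_ifs <;> simp

theorem truncArg_smul (r : ℝ) (u : X) (l : Fin 2) (p : Ω) :
    Q.truncArg (r • u) l p = r ^ 2 * Q.truncArg u l p := by
  unfold truncArg gradSq compSq
  cases Q.kind <;> simp [norm_smul, mul_pow, mul_add]

theorem lt_truncArg_smul {u : X} {l : Fin 2} {p : Ω} {r : ℝ} (hr : 1 < r)
    (hu : Q.lam / Q.mu ≤ Q.truncArg u l p) : Q.lam / Q.mu < Q.truncArg (r • u) l p := by
  have hpos : 0 < Q.truncArg u l p := (div_pos Q.lam_pos Q.mu_pos).trans_le hu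
  calc Q.lam / Q.mu ≤ Q.truncArg u l p := hu
    _ < r ^ 2 * Q.truncArg u l p := lt_mul_of_one_lt_left hpos (one_lt_pow₀ hr two_ne_zero)
    _ = Q.truncArg (r • u) l p := (Q.truncArg_smul r u l p).symm

variable [FiniteDimensional ℝ X]

theorem continuous_compSq (l : Fin 2) (p : Ω) : Continuous fun u => Q.compSq l u p :=
  ((LinearMap.proj p ∘ₗ Q.grad l).continuous_of_finiteDimensional.norm).pow 2

theorem continuous_gradSq (p : Ω) : Continuous fun u => Q.gradSq u p :=
  continuous_finsetSum _ fun l _ => Q.continuous_compSq l p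

theorem continuous_truncArg (l : Fin 2) (p : Ω) : Continuous fun u => Q.truncArg u l p := by
  unfold truncArg
  cases Q.kind
  · exact Q.continuous_gradSq p
  · exact Q.continuous_compSq l p

theorem eventually_chi_apply_eq {u : X} {l : Fin 2} {p : Ω}
    (hu : Q.truncArg u l p ≠ Q.lam / Q.mu) : ∀ᶠ z in 𝓝 u, Q.chi z l p = Q.chi u l p := by
  have hcont : Tendsto (fun z => Q.truncArg z l p) (𝓝 u) (𝓝 (Q.truncArg u l p)) :=
    (Q.continuous_truncArg l p).tendsto u
  rcases hu.lt_or_gt with hlt | hgt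
  · filter_upwards [hcont.eventually_lt_const hlt] with z hz
    rw [chi_eq_ite, chi_eq_ite, if_neg hlt.not_ge, if_neg hz.not_ge]
  · filter_upwards [hcont.eventually_const_lt hgt] with z hz
    rw [chi_eq_ite, chi_eq_ite, if_pos hgt.le, if_pos hz.le]

theorem eventually_eventually_chi_apply_eq (u : X) (l : Fin 2) (p : Ω) :
    ∀ᶠ ε : ℝ in 𝓝[>] 0, ∀ᶠ z in 𝓝 ((1 + ε) • u), Q.chi z l p = Q.chi u l p := by
  by_cases hu : Q.lam / Q.mu ≤ Q.truncArg u l p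
  · filter_upwards [self_mem_nhdsWithin] with ε hε
    have hlt := Q.lt_truncArg_smul (lt_add_of_pos_right 1 hε) hu
    filter_upwards [Q.eventually_chi_apply_eq hlt.ne'] with z hz
    rw [hz, chi_eq_ite, chi_eq_ite, if_pos hu, if_pos hlt.le]
  · exact (tendsto_one_add_smul_nhds u).eventually
      (Q.eventually_chi_apply_eq (not_le.1 hu).ne).eventually_nhds

theorem eventually_eventually_chi_eq [Finite Ω] (u : X) :
    ∀ᶠ ε : ℝ in 𝓝[>] 0, ∀ᶠ z in 𝓝 ((1 + ε) • u), Q.chi z = Q.chi u := by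
  have hall := eventually_all.2 fun l => eventually_all.2 (Q.eventually_eventually_chi_apply_eq u l)
  filter_upwards [hall] with ε hε
  filter_upwards [eventually_all.2 fun l => eventually_all.2 (hε l)] with z hz
  exact funext₂ hz

end Threshold

section Objective

theorem isQuadratic_f [FiniteDimensional ℝ X] [CompleteSpace X] :
    IsQuadratic Q.f (gradient Q.f) (gram (Q.A : X →ₗ[ℝ] Z)) := by
  have hf : IsQuadratic Q.f
      (fun u => (InnerProductSpace.toDual ℝ X).symm ((innerSL ℝ (Q.A u - Q.u0)).comp Q.A))
      (gram (Q.A : X →ₗ[ℝ] Z)) := by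
    refine ⟨isSymmetric_gram _, fun u v => ?_⟩
    have hsplit : Q.A v - Q.u0 = Q.A u - Q.u0 + Q.A (v - u) := by rw [map_sub]; abel
    rw [InnerProductSpace.toDual_symm_apply, inner_gram_self, ContinuousLinearMap.comp_apply,
      innerSL_apply_apply, ContinuousLinearMap.coe_coe, f, f, hsplit, norm_add_sq_real]
    ring
  rwa [← hf.gradient_eq] at hf

variable [Fintype Ω]

theorem P_nonneg (u : X) : 0 ≤ Q.P u := by
  have hmu : 0 ≤ Q.mu / 2 := (half_pos Q.mu_pos).le
  have hthreshold : 0 ≤ Q.lam / Q.mu := (div_pos Q.lam_pos Q.mu_pos).le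
  have hcomp (l : Fin 2) (p : Ω) : 0 ≤ Q.compSq l u p := sq_nonneg _
  unfold P gradSq
  cases Q.kind
  · exact Finset.sum_nonneg fun p _ => mul_nonneg hmu <|
      le_min (Finset.sum_nonneg fun l _ => hcomp l p) hthreshold
  · exact Finset.sum_nonneg fun p _ => mul_nonneg hmu <|
      Finset.sum_nonneg fun l _ => le_min (hcomp l p) hthreshold

theorem F_nonneg (u : X) : 0 ≤ Q.F u :=
  add_nonneg (div_nonneg (sq_nonneg _) zero_le_two) (Q.P_nonneg u)

theorem P_add_P2 (u : X) : Q.P u + Q.P2 u = Q.P1 u := by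
  unfold P P1 P2
  cases Q.kind <;> simp only [← Finset.sum_add_distrib, ← mul_add, min_add_max]

theorem F_eq (u : X) : Q.F u = Q.f u + Q.P1 u - Q.P2 u := by
  rw [F, ← P_add_P2]
  ring

theorem continuous_P [FiniteDimensional ℝ X] : Continuous Q.P := by
  have hcomp := Q.continuous_compSq
  have hgrad := Q.continuous_gradSq
  unfold P
  cases Q.kind <;> fun_prop

variable [FiniteDimensional ℝ X] (c : Fin 2 → Ω → ℝ)

/-- The operator `μ ∑ l, ∇_l^* c_l ∇_l` with pixelwise weights `c`. -/
noncomputable def weightedGram : X →ₗ[ℝ] X :=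
  Q.mu • ∑ l, ∑ p, c l p • gram (LinearMap.proj p ∘ₗ Q.grad l)

theorem weightedGram_apply (u : X) : Q.weightedGram c u =
    Q.mu • ∑ l, ∑ p, c l p • gram (LinearMap.proj p ∘ₗ Q.grad l) u := by
  simp only [weightedGram, LinearMap.smul_apply, LinearMap.sum_apply]

theorem weightedGram_sub (c' : Fin 2 → Ω → ℝ) (u : X) :
    Q.weightedGram (c - c') u = Q.weightedGram c u - Q.weightedGram c' u := by
  simp only [weightedGram_apply, Pi.sub_apply, sub_smul, Finset.sum_sub_distrib, smul_sub]

theorem isSymmetric_weightedGram : (Q.weightedGram c).IsSymmetric := fun u v => by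
  simp only [weightedGram_apply, real_inner_smul_left, real_inner_smul_right, sum_inner, inner_sum,
    isSymmetric_gram _ u v]

theorem inner_weightedGram_self (u : X) :
    ⟪Q.weightedGram c u, u⟫ = Q.mu * ∑ l, ∑ p, c l p * Q.compSq l u p := by
  simp only [weightedGram_apply, real_inner_smul_left, sum_inner, inner_gram_self]
  rfl

theorem inner_weightedGram_one_self_nonneg (u : X) : 0 ≤ ⟪Q.weightedGram 1 u, u⟫ := by
  rw [inner_weightedGram_self]
  exact mul_nonneg Q.mu_pos.le <| Finset.sum_nonneg fun l _ => Finset.sum_nonneg fun p _ =>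
    mul_nonneg zero_le_one (sq_nonneg _)

theorem subgradSel_eq [FiniteDimensional ℝ V] (u : X) :
    Q.subgradSel u = Q.weightedGram (Q.chi u) u := by
  simp only [subgradSel, weightedGram_apply, gram_apply, map_smul]
  rfl

theorem exists_P1_eq : ∃ k, ∀ u, Q.P1 u = 1 / 2 * ⟪Q.weightedGram 1 u, u⟫ + k := by
  refine ⟨Q.P1 0, fun u => ?_⟩
  rw [inner_weightedGram_self]
  unfold P1 gradSq compSq
  cases Q.kind <;>
  · simp only [Fin.sum_univ_two, ← Finset.sum_add_distrib, Finset.mul_sum]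
    refine Finset.sum_congr rfl fun p _ => ?_
    simp only [Pi.one_apply, one_mul, map_zero, Pi.zero_apply, norm_zero, ne_eq,
      OfNat.ofNat_ne_zero, not_false_eq_true, zero_pow, zero_add]
    ring

theorem isQuadratic_P1 : IsQuadratic Q.P1 (Q.weightedGram 1) (Q.weightedGram 1) := by
  obtain ⟨k, hk⟩ := Q.exists_P1_eq
  exact funext hk ▸ isQuadratic_half_inner (Q.isSymmetric_weightedGram 1) k

theorem exists_P_eq : ∃ k : (Fin 2 → Ω → ℝ) → ℝ, ∀ u,
    Q.P u = 1 / 2 * ⟪Q.weightedGram (1 - Q.chi u) u, u⟫ + k (Q.chi u) := by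
  have hmin (a b : ℝ) :
      min a b = (1 - if b ≤ a then 1 else 0) * a + (if b ≤ a then 1 else 0) * b := by
    split_ifs with hab
    · rw [min_eq_right hab]; ring
    · rw [min_eq_left (not_le.1 hab).le]; ring
  rcases hkind : Q.kind with _ | _
  · refine ⟨fun c => ∑ p, Q.mu / 2 * (c 0 p * (Q.lam / Q.mu)), fun u => ?_⟩
    rw [inner_weightedGram_self]
    simp only [P, hkind, hmin, Fin.sum_univ_two, ← Finset.sum_add_distrib, Finset.mul_sum]
    refine Finset.sum_congr rfl fun p _ => ?_
    simp only [Pi.sub_apply, Pi.one_apply, chi, hkind, gradSq, Fin.sum_univ_two]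
    ring
  · refine ⟨fun c => ∑ p, Q.mu / 2 * ∑ l, c l p * (Q.lam / Q.mu), fun u => ?_⟩
    rw [inner_weightedGram_self]
    simp only [P, hkind, hmin, Fin.sum_univ_two, ← Finset.sum_add_distrib, Finset.mul_sum]
    refine Finset.sum_congr rfl fun p _ => ?_
    simp only [Pi.sub_apply, Pi.one_apply, chi, hkind]
    ring

theorem continuous_F [CompleteSpace X] : Continuous Q.F :=
  Q.isQuadratic_f.continuous.add Q.continuous_P

theorem continuous_P2 [CompleteSpace X] : Continuous Q.P2 := by
  have hP2 : Q.P2 = fun u => Q.P1 u - Q.P u := funext fun u => eq_sub_of_add_eq' (Q.P_add_P2 u)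
  exact hP2 ▸ Q.isQuadratic_P1.continuous.sub Q.continuous_P

variable [CompleteSpace X]

theorem exists_isQuadratic_eq_F : ∃ q : X → ℝ,
    IsQuadratic q (fun u => gradient Q.f u + Q.weightedGram (1 - c) u)
      (gram (Q.A : X →ₗ[ℝ] Z) + Q.weightedGram (1 - c)) ∧ ∀ u, Q.chi u = c → Q.F u = q u := by
  obtain ⟨k, hk⟩ := Q.exists_P_eq
  refine ⟨_, Q.isQuadratic_f.add
    (isQuadratic_half_inner (Q.isSymmetric_weightedGram (1 - c)) (k c)), ?_⟩
  rintro u rfl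
  rw [F, hk]

/-- The gradient at `u` of the quadratic branch of `F` selected by `chi u`. -/
noncomputable def branchGradient (u : X) : X :=
  gradient Q.f u + Q.weightedGram (1 - Q.chi u) u

theorem mem_closure_regularSubdiff_branchGradient (u : X) :
    (u, Q.branchGradient u) ∈ closure {z : X × X | z.2 ∈ regularSubdiff Q.F z.1} := by
  obtain ⟨q, hq, hF⟩ := Q.exists_isQuadratic_eq_F (Q.chi u)
  have hlim := tendsto_one_add_smul_nhds u
  refine mem_closure_of_tendsto (hlim.prodMk_nhds ((hq.continuous_gradient.tendsto u).comp hlim)) ?_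
  filter_upwards [Q.eventually_eventually_chi_eq u] with ε hε
  exact mem_regularSubdiff_of_hasGradientAt <|
    (hq.hasGradientAt _).congr_of_eventuallyEq (hε.mono hF)

theorem isLimitingStationary_of_tendsto {ι : Type*} {l : Filter ι} [l.NeBot] {x : ι → X} {a : X}
    (hx : Tendsto x l (𝓝 a)) (hgrad : Tendsto (fun i => Q.branchGradient (x i)) l (𝓝 0)) :
    IsLimitingStationary Q.F a :=
  mem_limitingSubdiff_of_mem_closure Q.continuous_F.continuousAt <|
    isClosed_closure.mem_of_tendsto (hx.prodMk_nhds hgrad) <|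
      Eventually.of_forall fun i => Q.mem_closure_regularSubdiff_branchGradient (x i)

theorem isBigO_F_sub_branchGradient_sq {ι : Type*} {l : Filter ι} {x : ι → X} {E : ℝ}
    (hE : Tendsto (fun i => Q.F (x i)) l (𝓝 E))
    (hgrad : Tendsto (fun i => Q.branchGradient (x i)) l (𝓝 0)) :
    (fun i => Q.F (x i) - E) =O[l] fun i => ‖Q.branchGradient (x i)‖ ^ 2 := by
  refine isBigO_of_finite_range (χ := fun i => Q.chi (x i))
    (Q.finite_range_chi.subset (Set.range_comp_subset_range x Q.chi)) fun c => ?_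
  obtain ⟨q, hq, hF⟩ := Q.exists_isQuadratic_eq_F c
  have hbranch : ∀ᶠ i in l ⊓ 𝓟 ((fun i => Q.chi (x i)) ⁻¹' {c}), Q.chi (x i) = c :=
    mem_inf_of_right (mem_principal_self _)
  have hFq : (fun i => Q.F (x i)) =ᶠ[l ⊓ 𝓟 ((fun i => Q.chi (x i)) ⁻¹' {c})] fun i => q (x i) :=
    hbranch.mono fun i hi => hF _ hi
  have hgradq : (fun i => Q.branchGradient (x i)) =ᶠ[l ⊓ 𝓟 ((fun i => Q.chi (x i)) ⁻¹' {c})]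
      fun i => gradient Q.f (x i) + Q.weightedGram (1 - c) (x i) :=
    hbranch.mono fun i hi => by simp only [branchGradient, hi]
  exact (hq.isBigO_sub_gradient_sq ((hE.mono_left inf_le_left).congr' hFq)
    ((hgrad.mono_left inf_le_left).congr' hgradq)).congr'
      (hFq.symm.sub .rfl) ((hgradq.symm.fun_comp (‖·‖ ^ 2)))

end Objective

end TQProblem

namespace TQProblem

variable {X Z V Ω : Type*} [NormedAddCommGroup X] [InnerProductSpace ℝ X]
  [NormedAddCommGroup Z] [InnerProductSpace ℝ Z] [NormedAddCommGroup V] [InnerProductSpace ℝ V]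

theorem norm_sq_le_inner_of_lipschitzWith [FiniteDimensional ℝ X] [CompleteSpace X]
    {Q : TQProblem X Z V Ω} {M : X →ₗ[ℝ] X} {L : ℝ≥0} (hL : LipschitzWith L (gradient Q.f))
    (hML : (M - (L : ℝ) • LinearMap.id).IsPositive) (v : X) : ‖Q.A v‖ ^ 2 ≤ ⟪v, M v⟫ := by
  set T := gram (Q.A : X →ₗ[ℝ] Z)
  have hT : ‖T v‖ ≤ L * ‖v‖ := by
    have hdist := hL.dist_le_mul v 0
    rwa [dist_eq_norm, dist_zero_right, Q.isQuadratic_f.gradient_sub, sub_zero] at hdist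
  have hLM : L * ‖v‖ ^ 2 ≤ ⟪v, M v⟫ := by
    simpa [inner_sub_right, inner_smul_right] using hML.inner_nonneg_right v
  calc ‖Q.A v‖ ^ 2 = ⟪T v, v⟫ := (inner_gram_self _ v).symm
    _ ≤ ‖T v‖ * ‖v‖ := real_inner_le_norm _ _
    _ ≤ L * ‖v‖ * ‖v‖ := by gcongr
    _ = L * ‖v‖ ^ 2 := by ring
    _ ≤ ⟪v, M v⟫ := hLM

namespace IsPreDCAe

variable [CompleteSpace X] [Fintype Ω] {Q : TQProblem X Z V Ω}
  {M : X →ₗ[ℝ] X} {β : ℕ → ℝ} {x y ξ : ℕ → X}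

theorem sub_extrapolate (hx : Q.IsPreDCAe M β x y ξ) (t : ℕ) :
    x t - y t = -(β t • (x t - x (t - 1))) := by
  rw [hx.extrapolate, sub_add_cancel_left]

variable [FiniteDimensional ℝ X]

theorem subgrad_eq (hx : Q.IsPreDCAe M β x y ξ) (hM : M.IsSymmetric) (t : ℕ) :
    ξ t = gradient Q.f (y t) + M (x (t + 1) - y t) + Q.weightedGram 1 (x (t + 1)) := by
  have hmin := ((isQuadratic_inner_add_half_inner_sub hM (gradient Q.f (y t) - ξ t) (y t)).add
    Q.isQuadratic_P1).gradient_eq_zero_of_isMinOn (hx.argmin t)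
  rw [sub_add_eq_add_sub, sub_add_eq_add_sub, sub_eq_zero] at hmin
  exact hmin.symm

theorem branchGradient_eq [FiniteDimensional ℝ V] (hx : Q.IsPreDCAe M β x y ξ) (hM : M.IsSymmetric)
    (hξ : ∀ t, ξ t = Q.subgradSel (x t)) (t : ℕ) :
    Q.branchGradient (x t) = gram (Q.A : X →ₗ[ℝ] Z) (x t - y t) - M (x (t + 1) - y t) -
      Q.weightedGram 1 (x (t + 1) - x t) := by
  have hopt := hx.subgrad_eq hM t
  rw [hξ, subgradSel_eq] at hopt
  rw [branchGradient, weightedGram_sub, hopt, ← Q.isQuadratic_f.gradient_sub,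
    map_sub (Q.weightedGram 1)]
  abel

theorem F_succ_add_stepEnergy_le (hx : Q.IsPreDCAe M β x y ξ) (hM : M.IsSymmetric)
    (hAM : ∀ v, ‖Q.A v‖ ^ 2 ≤ ⟪v, M v⟫) (t : ℕ) :
    Q.F (x (t + 1)) + stepEnergy M x (t + 1) ≤ Q.F (x t) + β t ^ 2 * stepEnergy M x t := by
  have hprox := Q.isQuadratic_f.add_sub_le_of_isMinOn Q.isQuadratic_P1 hM
    (fun v => by rw [inner_gram_self]; exact sq_nonneg _)
    (fun v => by rw [inner_gram_self]; exact hAM v)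
    Q.inner_weightedGram_one_self_nonneg (hx.subgrad t) (hx.argmin t)
  rw [← F_eq, ← F_eq, hx.sub_extrapolate, map_neg, inner_neg_neg, map_smul, real_inner_smul_left,
    real_inner_smul_right] at hprox
  simp only [stepEnergy, add_tsub_cancel_right]
  linarith

theorem exists_isInertialDescent (hx : Q.IsPreDCAe M β x y ξ) (hM : M.IsSymmetric)
    (hAM : ∀ v, ‖Q.A v‖ ^ 2 ≤ ⟪v, M v⟫) :
    ∃ b, IsInertialDescent (fun t => Q.F (x t)) (stepEnergy M x) b := by
  have hβ : ∀ t, β t ≤ ⨆ t, β t :=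
    le_ciSup ⟨1, Set.forall_mem_range.2 fun t => (hx.beta_mem t).2.le⟩
  have hsup : 0 ≤ ⨆ t, β t := (hx.beta_mem 0).1.trans (hβ 0)
  have hnonneg (t : ℕ) : 0 ≤ stepEnergy M x t :=
    mul_nonneg one_half_pos.le ((sq_nonneg _).trans (hAM _))
  refine ⟨(⨆ t, β t) ^ 2, sq_nonneg _, pow_lt_one₀ hsup hx.beta_sup two_ne_zero, hnonneg,
    ⟨0, Set.forall_mem_range.2 fun t => Q.F_nonneg (x t)⟩, fun t => ?_⟩
  calc Q.F (x (t + 1)) + stepEnergy M x (t + 1) ≤ Q.F (x t) + β t ^ 2 * stepEnergy M x t :=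
      hx.F_succ_add_stepEnergy_le hM hAM t
    _ ≤ Q.F (x t) + (⨆ t, β t) ^ 2 * stepEnergy M x t := by
      gcongr
      exacts [hnonneg t, (hx.beta_mem t).1, hβ t]

section Residuals

variable (hx : Q.IsPreDCAe M β x y ξ) (hMpos : ∀ v, v ≠ 0 → 0 < ⟪v, M v⟫)
include hx hMpos

theorem sub_extrapolate_isBigO : (fun t => x t - y t) =O[atTop] twoStepLength M x := by
  refine IsBigO.trans (IsBigO.of_norm_le fun t => ?_) (sub_isBigO_twoStepLength hMpos x).norm_left
  rw [hx.sub_extrapolate, norm_neg, norm_smul, Real.norm_of_nonneg (hx.beta_mem t).1]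
  exact mul_le_of_le_one_left (norm_nonneg _) (hx.beta_mem t).2.le

theorem succ_sub_extrapolate_isBigO :
    (fun t => x (t + 1) - y t) =O[atTop] twoStepLength M x :=
  ((succ_sub_isBigO_twoStepLength hMpos x).add (hx.sub_extrapolate_isBigO hMpos)).congr_left
    fun _ => sub_add_sub_cancel _ _ _

theorem branchGradient_isBigO [FiniteDimensional ℝ V] (hM : M.IsSymmetric)
    (hξ : ∀ t, ξ t = Q.subgradSel (x t)) :
    (fun t => Q.branchGradient (x t)) =O[atTop] twoStepLength M x :=
  ((((isBigO_linearMap_comp _ _ _).trans (hx.sub_extrapolate_isBigO hMpos)).sub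
    ((isBigO_linearMap_comp _ _ _).trans (hx.succ_sub_extrapolate_isBigO hMpos))).sub
    ((isBigO_linearMap_comp _ _ _).trans (succ_sub_isBigO_twoStepLength hMpos x))).congr_left
      fun t => (hx.branchGradient_eq hM hξ t).symm

theorem gradient_add_gradient_P1_mem_convexSubdiff (hM : M.IsSymmetric)
    (hstep : Tendsto (twoStepLength M x) atTop (𝓝 0)) {a : X} (ha : MapClusterPt a atTop x) :
    gradient Q.f a + gradient Q.P1 a ∈ convexSubdiff Q.P2 a := by
  obtain ⟨U, hU, hxU⟩ := mapClusterPt_iff_ultrafilter.1 ha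
  have hyU : Tendsto y U (𝓝 a) := by
    simpa using hxU.sub (((hx.sub_extrapolate_isBigO hMpos).trans_tendsto hstep).mono_left hU)
  have hsuccU : Tendsto (fun t => x (t + 1)) U (𝓝 a) := by
    simpa using hxU.add
      (((succ_sub_isBigO_twoStepLength hMpos x).trans_tendsto hstep).mono_left hU)
  have hMU : Tendsto (fun t => M (x (t + 1) - y t)) U (𝓝 0) :=
    ((isBigO_linearMap_comp M _ _).trans (hx.succ_sub_extrapolate_isBigO hMpos)).trans_tendsto
      hstep |>.mono_left hU
  have hξU : Tendsto ξ U (𝓝 (gradient Q.f a + 0 + Q.weightedGram 1 a)) :=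
    ((((Q.isQuadratic_f.continuous_gradient.tendsto a).comp hyU).add hMU).add
      ((Q.isQuadratic_P1.continuous_gradient.tendsto a).comp hsuccU)).congr
        fun t => (hx.subgrad_eq hM t).symm
  rw [add_zero, ← Q.isQuadratic_P1.gradient_eq] at hξU
  exact mem_convexSubdiff_of_tendsto Q.continuous_P2.continuousAt hxU hξU hx.subgrad

end Residuals

section Convergence

variable (hx : Q.IsPreDCAe M β x y ξ) (hM : M.IsSymmetric)
  (hMpos : ∀ v, v ≠ 0 → 0 < ⟪v, M v⟫) (hAM : ∀ v, ‖Q.A v‖ ^ 2 ≤ ⟪v, M v⟫)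
include hx hM hAM

theorem tendsto_twoStepLength : Tendsto (twoStepLength M x) atTop (𝓝 0) := by
  obtain ⟨b, hdescent⟩ := hx.exists_isInertialDescent hM hAM
  have hsum : Tendsto (fun t => stepEnergy M x t + stepEnergy M x (t + 1)) atTop (𝓝 0) := by
    simpa using hdescent.tendsto_zero.add (hdescent.tendsto_zero.comp (tendsto_add_atTop_nat 1))
  exact Real.sqrt_zero ▸ hsum.sqrt

include hMpos

theorem summable_norm_sub [FiniteDimensional ℝ V] (hξ : ∀ t, ξ t = Q.subgradSel (x t)) :
    Summable fun t => ‖x (t + 1) - x t‖ := by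
  obtain ⟨b, hdescent⟩ := hx.exists_isInertialDescent hM hAM
  have hgrad := hx.branchGradient_isBigO hMpos hM hξ
  have hgap : (fun t => Q.F (x t) -
      ⨅ t, IsInertialDescent.energy (fun t => Q.F (x t)) (stepEnergy M x) b t) =O[atTop]
        fun t => stepEnergy M x t + stepEnergy M x (t + 1) :=
    ((Q.isBigO_F_sub_branchGradient_sq hdescent.tendsto_objective
      (hgrad.trans_tendsto (hx.tendsto_twoStepLength hM hAM))).trans
        (hgrad.norm_left.pow 2)).congr_right (twoStepLength_sq hMpos x)
  have hsucc := (sub_isBigO_sqrt_stepEnergy hMpos x).norm_left.comp_tendsto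
    (tendsto_add_atTop_nat 1)
  exact summable_of_isBigO_nat ((summable_nat_add_iff 1).2 (hdescent.summable_sqrt hgap)) hsucc

end Convergence

end IsPreDCAe

end TQProblem

theorem mainTheorem1_general {X Z V Ω : Type*}
    [NormedAddCommGroup X] [InnerProductSpace ℝ X] [FiniteDimensional ℝ X] [CompleteSpace X]
    [NormedAddCommGroup Z] [InnerProductSpace ℝ Z]
    [NormedAddCommGroup V] [InnerProductSpace ℝ V] [FiniteDimensional ℝ V]
    [Fintype Ω]
    (Q : TQProblem X Z V Ω) (M : X →ₗ[ℝ] X) (hMsymm : M.IsSymmetric)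
    (hMpos : ∀ v, v ≠ 0 → 0 < ⟪v, M v⟫) (hAM : ∀ v, ‖Q.A v‖ ^ 2 ≤ ⟪v, M v⟫)
    (β : ℕ → ℝ) (x y ξ : ℕ → X) (hx : Q.IsPreDCAe M β x y ξ) :
    (∀ a, MapClusterPt a atTop x →
      ∃ η ∈ convexSubdiff Q.P2 a, gradient Q.f a + gradient Q.P1 a - η = 0) ∧
    ((∀ t, ξ t = Q.subgradSel (x t)) →
      (∀ a, MapClusterPt a atTop x → IsLimitingStationary Q.F a) ∧
      Summable (fun t => ‖x (t + 1) - x t‖) ∧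
      ∃ a, IsLimitingStationary Q.F a ∧ Tendsto x atTop (𝓝 a)) := by
  have hstep := hx.tendsto_twoStepLength hMsymm hAM
  refine ⟨fun a ha => ⟨_, hx.gradient_add_gradient_P1_mem_convexSubdiff hMpos hMsymm hstep ha,
    sub_self _⟩, fun hξ => ?_⟩
  have hgrad : Tendsto (fun t => Q.branchGradient (x t)) atTop (𝓝 0) :=
    (hx.branchGradient_isBigO hMpos hMsymm hξ).trans_tendsto hstep
  have hstationary (a : X) (ha : MapClusterPt a atTop x) : IsLimitingStationary Q.F a := by
    obtain ⟨U, hU, hxU⟩ := mapClusterPt_iff_ultrafilter.1 ha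
    exact Q.isLimitingStationary_of_tendsto hxU (hgrad.mono_left hU)
  have hsummable := hx.summable_norm_sub hMsymm hMpos hAM hξ
  have hcauchy : CauchySeq x := cauchySeq_of_summable_dist <| by
    simpa only [dist_eq_norm', Nat.succ_eq_add_one] using hsummable
  obtain ⟨a, ha⟩ := cauchySeq_tendsto_of_complete hcauchy
  exact ⟨hstationary, hsummable, a, hstationary a ha.mapClusterPt, ha⟩

theorem mainTheorem1 {X Z V Ω : Type*}
    [NormedAddCommGroup X] [InnerProductSpace ℝ X] [FiniteDimensional ℝ X] [CompleteSpace X]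
    [NormedAddCommGroup Z] [InnerProductSpace ℝ Z]
    [NormedAddCommGroup V] [InnerProductSpace ℝ V] [FiniteDimensional ℝ V]
    [Fintype Ω]
    (Q : TQProblem X Z V Ω) (hF : LevelBounded Q.F)
    (L : ℝ≥0) (hL : LipschitzWith L (gradient Q.f))
    (M : X →ₗ[ℝ] X) (hMsymm : M.IsSymmetric) (hMpos : ∀ v, v ≠ 0 → 0 < ⟪v, M v⟫)
    (hML : (M - (L : ℝ) • LinearMap.id).IsPositive)
    (β : ℕ → ℝ) (x y ξ : ℕ → X) (hx : Q.IsPreDCAe M β x y ξ) :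
    (∀ a, MapClusterPt a atTop x →
      ∃ η ∈ convexSubdiff Q.P2 a, gradient Q.f a + gradient Q.P1 a - η = 0) ∧
    ((∀ t, ξ t = Q.subgradSel (x t)) →
      (∀ a, MapClusterPt a atTop x → IsLimitingStationary Q.F a) ∧
      Summable (fun t => ‖x (t + 1) - x t‖) ∧
      ∃ a, IsLimitingStationary Q.F a ∧ Tendsto x atTop (𝓝 a)) :=
  mainTheorem1_general Q M hMsymm hMpos
    (TQProblem.norm_sq_le_inner_of_lipschitzWith hL hML) β x y ξ hx
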